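/- Let $\mathbb K$ be $\mathbb R$ or $\mathbb C$. For a Banach space $X$ over $\mathbb K$ and a bounded linear operator $T$ on $X$, put $$v(T)=\sup\{|x^*(Tx)| : x\in X,\ x^*\in X^*,\ \|x\|=\|x^*\|=x^*(x)=1\},$$ and let $n(X)=\inf\{v(T) : T\in L(X),\ \|T\|=1\}$ be the numerical index of $X$. Let $c$ be the space of convergent scalar sequences $x=(x(1),x(2),\dots)$ with the supremum norm, and define $$X_1=\{(x,y,z)\in c\oplus_\infty c\oplus_\infty c : \lim x+\lim y+\lim z=0\},$$ $$X_2=\{(x,y,z)\in c\oplus_\infty c\oplus_\infty c : x(1)+y(1)+z(1)=0\},$$ $$H=\{(a,b,d)\in \ell_\infty^{(3)} : a+b+d=0\}.$$ Then $X_1$ and $X_2$ are Banach spaces, and they are isometric preduals of one and the same Banach space $Z$, that is, $X_1^*$ and $X_2^*$ are both isometrically isomorphic to $Z$; nevertheless $n(X_1)\neq n(X_2)$. More precisely, $n(X_1)=1$; the space $H$ is isometrically isomorphic to an $M$-summand of $X_2$ (the range of a bounded linear projection $P$ on $X_2$ such that $\|w\|=\max\{\|Pw\|,\|w-Pw\|\}$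 for all $w\in X_2$); $n(H)<1$; and $n(X_2)<1$. -/

import Mathlib

open Filter Topology
open scoped BoundedContinuousFunction

universe u v

section General

variable (𝕜 : Type u) [RCLike 𝕜]

/-- The numerical range `V(T) = {x*(T x) : ‖x‖ = ‖x*‖ = 1, x*(x) = 1}`. -/
def numericalRange {X : Type v} [NormedAddCommGroup X] [NormedSpace 𝕜 X] (T : X →L[𝕜] X) :
    Set 𝕜 :=
  {a | ∃ (x : X) (f : StrongDual 𝕜 X), ‖x‖ = 1 ∧ ‖f‖ = 1 ∧ f x = 1 ∧ a = f (T x)}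

/-- The numerical radius `v(T) = sup {|a| : a ∈ V(T)}`. -/
noncomputable def numericalRadius {X : Type v} [NormedAddCommGroup X] [NormedSpace 𝕜 X]
    (T : X →L[𝕜] X) : ℝ :=
  sSup ((fun a : 𝕜 => ‖a‖) '' numericalRange 𝕜 T)

/-- The numerical index `n(X) = inf {v(T) : T ∈ L(X), ‖T‖ = 1}`. -/
noncomputable def numericalIndex (X : Type v) [NormedAddCommGroup X] [NormedSpace 𝕜 X] : ℝ :=
  sInf ((fun T : X →L[𝕜] X => numericalRadius 𝕜 T) '' {T | ‖T‖ = 1})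

/-- `X` is an isometric predual of `Z`: a Banach space whose dual is isometrically isomorphic
to `Z`. -/
def IsIsometricPredual (X Z : Type v) [NormedAddCommGroup X] [NormedSpace 𝕜 X]
    [NormedAddCommGroup Z] [NormedSpace 𝕜 Z] : Prop :=
  CompleteSpace X ∧ Nonempty (StrongDual 𝕜 X ≃ₗᵢ[𝕜] Z)

/-- `J` is an M-summand of `X`: the range of a bounded linear projection `P` on `X` with
`‖x‖ = max ‖P x‖ ‖x - P x‖` for all `x`. -/
def IsMSummand {X : Type v} [NormedAddCommGroup X] [NormedSpace 𝕜 X] (J : Submodule 𝕜 X) :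
    Prop :=
  ∃ P : X →L[𝕜] X, IsMprojection X P ∧ LinearMap.range (P : X →ₗ[𝕜] X) = J

/-- `H` is isometrically isomorphic to an M-summand of `X`. -/
def IsometricToMSummand (H X : Type v) [NormedAddCommGroup H] [NormedSpace 𝕜 H]
    [NormedAddCommGroup X] [NormedSpace 𝕜 X] : Prop :=
  ∃ J : Submodule 𝕜 X, IsMSummand 𝕜 J ∧ Nonempty (H ≃ₗᵢ[𝕜] J)

/-- The Banach space `c` of convergent scalar sequences with the sup norm
(a function on the discrete space `ℕ` is automatically continuous). -/
def convSeq : Submodule 𝕜 (ℕ →ᵇ 𝕜) where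
  carrier := {x | ∃ l : 𝕜, Tendsto (fun n => x n) atTop (𝓝 l)}
  add_mem' := by
    rintro x y ⟨a, ha⟩ ⟨b, hb⟩
    exact ⟨a + b, by simpa using ha.add hb⟩
  zero_mem' := ⟨0, by simp⟩
  smul_mem' := by
    rintro r x ⟨a, ha⟩
    exact ⟨r * a, by simpa using ha.const_mul r⟩

variable {𝕜} in
/-- The limit of a convergent sequence. -/
noncomputable def seqLim (x : convSeq 𝕜) : 𝕜 := limUnder atTop (fun n : ℕ => x.1 n)

variable {𝕜} in
theorem tendsto_seqLim (x : convSeq 𝕜) : Tendsto (fun n : ℕ => x.1 n) atTop (𝓝 (seqLim x)) :=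
  tendsto_nhds_limUnder x.2

/-- `X₁ = {(x, y, z) ∈ c ⊕_∞ c ⊕_∞ c : lim x + lim y + lim z = 0}`; functions on `Fin 3` carry
the maximum norm. -/
noncomputable def spaceX₁ : Submodule 𝕜 (Fin 3 → convSeq 𝕜) where
  carrier := {w | seqLim (w 0) + seqLim (w 1) + seqLim (w 2) = 0}
  add_mem' := by
    intro a b ha hb
    have key : ∀ i, seqLim ((a + b) i) = seqLim (a i) + seqLim (b i) := fun i =>
      tendsto_nhds_unique (tendsto_seqLim _)
        (by simpa using (tendsto_seqLim (a i)).add (tendsto_seqLim (b i)))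
    simp only [Set.mem_ofPred_eq, key] at *
    linear_combination ha + hb
  zero_mem' := by
    have key : seqLim (0 : convSeq 𝕜) = 0 :=
      tendsto_nhds_unique (tendsto_seqLim _) (by simp)
    simp [key]
  smul_mem' := by
    intro r a ha
    have key : ∀ i, seqLim ((r • a) i) = r * seqLim (a i) := fun i =>
      tendsto_nhds_unique (tendsto_seqLim _)
        (by simpa using (tendsto_seqLim (a i)).const_mul r)
    simp only [Set.mem_ofPred_eq, key] at *
    linear_combination r * ha

/-- `X₂ = {(x, y, z) ∈ c ⊕_∞ c ⊕_∞ c : x(1) + y(1) + z(1) = 0}`; the first term of a sequence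
has index `0` here. -/
def spaceX₂ : Submodule 𝕜 (Fin 3 → convSeq 𝕜) where
  carrier := {w | (w 0).1 0 + (w 1).1 0 + (w 2).1 0 = 0}
  add_mem' := by
    intro a b ha hb
    simp only [Set.mem_ofPred_eq, Pi.add_apply, Submodule.coe_add,
      BoundedContinuousFunction.coe_add] at *
    linear_combination ha + hb
  zero_mem' := by simp
  smul_mem' := by
    intro r a ha
    simp only [Set.mem_ofPred_eq, Pi.smul_apply, Submodule.coe_smul,
      BoundedContinuousFunction.coe_smul, smul_eq_mul] at *
    linear_combination r * ha

/-- The two-dimensional space `{(a, b, c) ∈ ℓ_∞^(3) : a + b + c = 0}`. -/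
def hexSpace : Submodule 𝕜 (Fin 3 → 𝕜) where
  carrier := {w | w 0 + w 1 + w 2 = 0}
  add_mem' := by
    intro a b ha hb
    simp only [Set.mem_ofPred_eq, Pi.add_apply] at *
    linear_combination ha + hb
  zero_mem' := by simp
  smul_mem' := by
    intro r a ha
    simp only [Set.mem_ofPred_eq, Pi.smul_apply, smul_eq_mul] at *
    linear_combination r * ha

end General

/-! ### Duals of spaces with a coordinate system -/

section DualOfCoordinateSystem

variable {𝕜 : Type*} [RCLike 𝕜]

/-! Both spaces carry a supremum norm over countably many coordinates: one coordinate lives in the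
hexagonal space `H`, the others in `ℓ_∞^(3)`, and one distinguished coordinate is a limit of the
others. As for `c* = ℓ₁`, the dual is the `ℓ₁`-sum of the duals of all coordinate spaces, and it
does not remember which coordinate is the limit
(`CoordinateSystem.nonempty_dual_linearIsometryEquiv`). In `X₁` the space `H` sits at the limit, in
`X₂` at the first term, so the two duals coincide.

The numerical index does see the difference. In `X₁` the norm is already determined by the scalar
terms, each of which can be changed without disturbing the others or the limit; this forces `‖T‖ =
v(T)` for every `T` (`norm_le_numericalRadius_of_coordinates`). In `X₂` the space `H` is an
M-summand, and the index cannot exceed that of an M-summand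
(`IsometricToMSummand.numericalIndex_le`). Finally `n(H) < 1` is witnessed by `hexRotation`, which
has norm one and numerical radius at most `√3 / 2`. -/

theorem exists_apply_eq_ofReal_of_norm_sub_le {V : Type*} [NormedAddCommGroup V] [NormedSpace 𝕜 V]
    (f : StrongDual 𝕜 V) {ε : ℝ} (hε : 0 < ε) :
    ∃ e : V, ‖e‖ ≤ 1 ∧ ∃ r : ℝ, f e = (r : 𝕜) ∧ ‖f‖ - ε ≤ r := by
  obtain ⟨x, hx, hfx⟩ := f.exists_lt_apply_of_lt_opNorm (sub_lt_self ‖f‖ hε)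
  obtain ⟨c, hc, hcx⟩ := RCLike.exists_norm_eq_mul_self (f x)
  refine ⟨c • x, by rw [norm_smul, hc, one_mul]; exact hx.le, ‖f x‖, ?_, hfx.le⟩
  rw [map_smul, smul_eq_mul, ← hcx]

/-- Families of functionals that are jointly bounded on products of unit balls have sums of
norms bounded by the same constant. -/
theorem norm_add_sum_norm_le {I V₀ : Type*} {V : I → Type*} [NormedAddCommGroup V₀]
    [NormedSpace 𝕜 V₀] [∀ i, NormedAddCommGroup (V i)] [∀ i, NormedSpace 𝕜 (V i)]
    (g : StrongDual 𝕜 V₀) (a : ∀ i, StrongDual 𝕜 (V i)) (s : Finset I) {C : ℝ}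
    (h : ∀ (e₀ : V₀) (e : ∀ i, V i), ‖e₀‖ ≤ 1 → (∀ i, ‖e i‖ ≤ 1) →
      ‖g e₀ + ∑ i ∈ s, a i (e i)‖ ≤ C) :
    ‖g‖ + ∑ i ∈ s, ‖a i‖ ≤ C := by
  -- Each of the `1 + s.card` functionals is normed up to `ε`, with a real value, so the
  -- near-norming vectors can be used together without cancellation.
  have key : ∀ ε : ℝ, 0 < ε → ‖g‖ + ∑ i ∈ s, ‖a i‖ ≤ C + ε * (1 + s.card) := by
    intro ε hε
    obtain ⟨e₀, he₀, r₀, hr₀, hgr₀⟩ := exists_apply_eq_ofReal_of_norm_sub_le g hε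
    choose e he r hr hgr using fun i => exists_apply_eq_ofReal_of_norm_sub_le (a i) hε
    have h1 := h e₀ e he₀ he
    have h2 : g e₀ + ∑ i ∈ s, a i (e i) = ((r₀ + ∑ i ∈ s, r i : ℝ) : 𝕜) := by
      push_cast
      rw [hr₀]
      simp only [hr]
    rw [h2, RCLike.norm_ofReal] at h1
    have h3 : ∑ i ∈ s, ‖a i‖ ≤ ∑ i ∈ s, (r i + ε) :=
      Finset.sum_le_sum fun i _ => by linarith [hgr i]
    rw [Finset.sum_add_distrib, Finset.sum_const, nsmul_eq_mul] at h3
    linarith [le_abs_self (r₀ + ∑ i ∈ s, r i)]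
  refine le_of_forall_pos_le_add fun δ hδ => ?_
  have hpos : (0 : ℝ) < 1 + s.card := by positivity
  have h := key (δ / (1 + s.card)) (by positivity)
  rwa [div_mul_cancel₀ _ hpos.ne'] at h

/-- A contractive injective linear map such that every vector of the codomain has a preimage of
at most the same norm is an isometric isomorphism. -/
theorem nonempty_linearIsometryEquiv_of_contractive {Y Z : Type*} [NormedAddCommGroup Y]
    [NormedSpace 𝕜 Y] [NormedAddCommGroup Z] [NormedSpace 𝕜 Z] (Φ : Z →ₗ[𝕜] Y)
    (hΦ : ∀ z, ‖Φ z‖ ≤ ‖z‖) (hinj : ∀ z, Φ z = 0 → z = 0)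
    (hsurj : ∀ y, ∃ z, Φ z = y ∧ ‖z‖ ≤ ‖y‖) : Nonempty (Y ≃ₗᵢ[𝕜] Z) := by
  have hnorm : ∀ z, ‖Φ z‖ = ‖z‖ := by
    intro z
    obtain ⟨z', hz', hn⟩ := hsurj (Φ z)
    have : z' - z = 0 := hinj _ (by rw [map_sub, hz', sub_self])
    rw [sub_eq_zero.1 this] at hn
    exact le_antisymm (hΦ z) hn
  exact ⟨(LinearIsometryEquiv.ofSurjective (⟨Φ, hnorm⟩ : Z →ₗᵢ[𝕜] Y)
    fun y => (hsurj y).imp fun z hz => hz.1).symm⟩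

/-- Coordinates `p i` on a normed space `X` carrying the supremum norm, such that the vectors
whose coordinate at `o` vanishes are those whose coordinates tend to zero: `κ i` places a vector
in the coordinate `i ≠ o`, and `τ` lifts a vector of the coordinate `o`. -/
structure CoordinateSystem (𝕜 : Type*) [RCLike 𝕜] {I : Type*} (X : Type*) (F : I → Type*)
    [NormedAddCommGroup X] [NormedSpace 𝕜 X] [∀ i, NormedAddCommGroup (F i)]
    [∀ i, NormedSpace 𝕜 (F i)] (o : I) where
  p : ∀ i, X →L[𝕜] F i
  κ : ∀ i, F i →L[𝕜] X
  τ : F o →L[𝕜] X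
  norm_p_le : ∀ i x, ‖p i x‖ ≤ ‖x‖
  norm_le : ∀ x r, 0 ≤ r → (∀ i, ‖p i x‖ ≤ r) → ‖x‖ ≤ r
  p_κ_ne : ∀ i j e, j ≠ i → p j (κ i e) = 0
  p_κ_self : ∀ i e, i ≠ o → p i (κ i e) = e
  κ_base : ∀ e, κ o e = 0
  p_τ : ∀ e, p o (τ e) = e
  norm_p_τ_le : ∀ i e, ‖p i (τ e)‖ ≤ ‖e‖
  tendsto_zero : ∀ x, p o x = 0 → Tendsto (fun i => ‖p i x‖) cofinite (𝓝 0)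

namespace CoordinateSystem

variable {I : Type*} {X : Type*} {F : I → Type*}
    [NormedAddCommGroup X] [NormedSpace 𝕜 X] [∀ i, NormedAddCommGroup (F i)]
    [∀ i, NormedSpace 𝕜 (F i)] {o : I} (S : CoordinateSystem 𝕜 X F o)

theorem p_sum_κ [DecidableEq I] (s : Finset I) (e : ∀ i, F i) (j : I) :
    S.p j (∑ i ∈ s, S.κ i (e i)) = if j ∈ s ∧ j ≠ o then e j else 0 := by
  rw [map_sum]
  split_ifs with h
  · rw [Finset.sum_eq_single_of_mem j h.1 fun i _ hi => S.p_κ_ne i j _ hi.symm,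
      S.p_κ_self j _ h.2]
  · refine Finset.sum_eq_zero fun i hi => ?_
    by_cases hij : j = i
    · subst hij
      have : j = o := by
        by_contra hne
        exact h ⟨hi, hne⟩
      subst this
      rw [S.κ_base, map_zero]
    · exact S.p_κ_ne i j _ hij

/-- Only finitely many coordinates exceed a given `ε / 2`; removing them leaves a vector of norm at
most `ε / 2`, because the norm is the supremum of the coordinates. -/
theorem hasSum_κ_p (x : X) (hx : S.p o x = 0) : HasSum (fun i => S.κ i (S.p i x)) x := by
  classical
  rw [HasSum, SummationFilter.unconditional_filter, Metric.tendsto_atTop]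
  intro ε hε
  have h := (S.tendsto_zero x hx).eventually (gt_mem_nhds (half_pos hε))
  have hfin : {i | ¬ ‖S.p i x‖ < ε / 2}.Finite := h
  refine ⟨hfin.toFinset, fun s hs => ?_⟩
  rw [dist_eq_norm]
  refine lt_of_le_of_lt (S.norm_le _ (ε / 2) (half_pos hε).le fun j => ?_) (half_lt_self hε)
  rw [map_sub, S.p_sum_κ]
  split_ifs with hj
  · simpa using (half_pos hε).le
  · by_cases hjo : j = o
    · subst hjo
      simpa [hx] using (half_pos hε).le
    · have hjs : j ∉ s := fun hjs => hj ⟨hjs, hjo⟩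
      rw [zero_sub, norm_neg]
      by_contra hlt
      exact hjs (hs (hfin.mem_toFinset.2 fun h' => hlt h'.le))

/-- Overwriting finitely many coordinates of the lift `τ e₀` by arbitrary unit-ball vectors stays in
the unit ball; evaluating `φ` there gives the estimate. Letting `s` grow bounds the `ℓ₁`-norm of the
family representing `φ`. -/
theorem norm_sub_sum_add_sum_le (φ : StrongDual 𝕜 X) (s : Finset I) :
    ‖φ.comp S.τ - ∑ i ∈ s, ((φ.comp (S.κ i)).comp (S.p i)).comp S.τ‖ +
      ∑ i ∈ s, ‖φ.comp (S.κ i)‖ ≤ ‖φ‖ := by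
  classical
  refine norm_add_sum_norm_le _ _ _ fun e₀ e he₀ he => ?_
  have h1 : (φ.comp S.τ - ∑ i ∈ s, ((φ.comp (S.κ i)).comp (S.p i)).comp S.τ) e₀ +
      ∑ i ∈ s, (φ.comp (S.κ i)) (e i) =
      φ (S.τ e₀ + ∑ i ∈ s, S.κ i (e i - S.p i (S.τ e₀))) := by
    simp [map_sum, Finset.sum_sub_distrib]
    ring
  rw [h1]
  refine (φ.le_opNorm _).trans (mul_le_of_le_one_right (norm_nonneg _) ?_)
  refine S.norm_le _ 1 zero_le_one fun j => ?_
  rw [map_add, S.p_sum_κ s (fun i => e i - S.p i (S.τ e₀))]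
  split_ifs with hj
  · rw [add_sub_cancel]
    exact he j
  · rw [add_zero]
    exact (S.norm_p_τ_le j e₀).trans he₀

theorem summable_apply (f : lp (fun i => StrongDual 𝕜 (F i)) 1) :
    Summable fun i => ‖f i‖ := by
  simpa using (lp.memℓp f).summable (by simp)

theorem norm_lp_one (f : lp (fun i => StrongDual 𝕜 (F i)) 1) :
    ‖f‖ = ∑' i, ‖f i‖ := by
  simpa using lp.norm_eq_tsum_rpow (p := 1) (by simp) f

theorem norm_apply_p_le (f : lp (fun i => StrongDual 𝕜 (F i)) 1) (x : X) (i : I) :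
    ‖f i (S.p i x)‖ ≤ ‖f i‖ * ‖x‖ :=
  ((f i).le_opNorm _).trans (mul_le_mul_of_nonneg_left (S.norm_p_le i x) (norm_nonneg _))

theorem summable_apply_p (f : lp (fun i => StrongDual 𝕜 (F i)) 1) (x : X) :
    Summable fun i => f i (S.p i x) :=
  .of_norm_bounded ((summable_apply f).mul_right ‖x‖) (S.norm_apply_p_le f x)

theorem norm_tsum_apply_p_le (f : lp (fun i => StrongDual 𝕜 (F i)) 1) (x : X) :
    ‖∑' i, f i (S.p i x)‖ ≤ ‖f‖ * ‖x‖ := by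
  rw [norm_lp_one, ← tsum_mul_right]
  exact tsum_of_norm_bounded ((summable_apply f).mul_right ‖x‖).hasSum (S.norm_apply_p_le f x)

/-- The pairing of summable families of functionals on the coordinates with `X`. -/
noncomputable def pairing : lp (fun i => StrongDual 𝕜 (F i)) 1 →ₗ[𝕜] StrongDual 𝕜 X where
  toFun f := LinearMap.mkContinuous
    { toFun := fun x => ∑' i, f i (S.p i x)
      map_add' := fun x y => by
        simp only [map_add]
        exact (S.summable_apply_p f x).tsum_add (S.summable_apply_p f y)
      map_smul' := fun c x => by
        simp only [map_smul, RingHom.id_apply]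
        exact (S.summable_apply_p f x).tsum_const_smul c } ‖f‖ (S.norm_tsum_apply_p_le f)
  map_add' f g := by
    ext x
    exact (S.summable_apply_p f x).tsum_add (S.summable_apply_p g x)
  map_smul' c f := by
    ext x
    exact (S.summable_apply_p f x).tsum_const_smul c

theorem pairing_apply (f : lp (fun i => StrongDual 𝕜 (F i)) 1) (x : X) :
    S.pairing f x = ∑' i, f i (S.p i x) := rfl

/-- Testing on `κ i e` isolates each index other than `o`; once those components vanish, testing on
`τ e` isolates the one at `o`. -/
theorem pairing_eq_zero (f : lp (fun i => StrongDual 𝕜 (F i)) 1) (hf : S.pairing f = 0) :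
    f = 0 := by
  have hne : ∀ i, i ≠ o → f i = 0 := by
    intro i hi
    ext e
    have h := DFunLike.congr_fun hf (S.κ i e)
    rw [pairing_apply, tsum_eq_single i fun j hj => by rw [S.p_κ_ne i j e hj, map_zero],
      S.p_κ_self i e hi] at h
    exact h
  ext i : 2
  by_cases hi : i = o
  · subst hi
    ext e
    have h := DFunLike.congr_fun hf (S.τ e)
    rw [pairing_apply, tsum_eq_single i fun j hj => by rw [hne j hj]; rfl, S.p_τ] at h
    exact h
  · exact hne i hi

theorem exists_pairing_eq (φ : StrongDual 𝕜 X) :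
    ∃ f, S.pairing f = φ ∧ ‖f‖ ≤ ‖φ‖ := by
  classical
  have hsum : Summable fun i => ‖φ.comp (S.κ i)‖ :=
    summable_of_sum_le (fun _ => norm_nonneg _) fun s =>
      (le_add_of_nonneg_left (norm_nonneg _)).trans (S.norm_sub_sum_add_sum_le φ s)
  have hsum' : Summable fun i => ((φ.comp (S.κ i)).comp (S.p i)).comp S.τ := by
    refine .of_norm_bounded hsum fun i => ?_
    refine ContinuousLinearMap.opNorm_le_bound _ (norm_nonneg _) fun e => ?_
    exact ((φ.comp (S.κ i)).le_opNorm _).trans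
      (mul_le_mul_of_nonneg_left (S.norm_p_τ_le i e) (norm_nonneg _))
  -- The component at `o` is what remains of `φ` on the lift after the contributions of the other
  -- coordinates of that lift are removed.
  set g : StrongDual 𝕜 (F o) :=
    φ.comp S.τ - ∑' i, ((φ.comp (S.κ i)).comp (S.p i)).comp S.τ with hg
  let a : lp (fun i => StrongDual 𝕜 (F i)) 1 :=
    ⟨fun i => φ.comp (S.κ i), memℓp_gen (by simpa using hsum)⟩
  have hbound : ‖g‖ + ‖a‖ ≤ ‖φ‖ := by
    rw [norm_lp_one]
    exact le_of_tendsto' ((tendsto_const_nhds.sub hsum'.hasSum).norm.add hsum.hasSum)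
      (S.norm_sub_sum_add_sum_le φ)
  refine ⟨lp.single 1 o g + a, ?_, ?_⟩
  · ext x
    have h1 : S.pairing (lp.single 1 o g) x = g (S.p o x) := by
      rw [pairing_apply, tsum_eq_single o fun j hj => by
        rw [lp.single_apply_ne _ _ _ hj]; rfl, lp.single_apply_self]
    have h2 : ∀ y, S.p o y = 0 → S.pairing a y = φ y := fun y hy =>
      ((S.hasSum_κ_p y hy).mapL φ).tsum_eq
    have h3 : S.pairing a (S.τ (S.p o x)) =
        (∑' i, ((φ.comp (S.κ i)).comp (S.p i)).comp S.τ) (S.p o x) :=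
      ((hsum'.hasSum.mapL (ContinuousLinearMap.apply 𝕜 𝕜 (S.p o x))).tsum_eq)
    -- Subtracting the lift of its own base coordinate leaves a vector that is the sum of its
    -- coordinate pieces, where `a` alone reproduces `φ`.
    have h4 := h2 (x - S.τ (S.p o x)) (by rw [map_sub, S.p_τ, sub_self])
    rw [map_sub, map_sub, h3] at h4
    rw [map_add, add_apply, h1, hg, sub_apply,
      ContinuousLinearMap.comp_apply]
    linear_combination h4
  · refine (norm_add_le _ _).trans ?_
    rw [lp.norm_single one_pos]
    exact hbound

theorem nonempty_dual_linearIsometryEquiv (S : CoordinateSystem 𝕜 X F o) :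
    Nonempty (StrongDual 𝕜 X ≃ₗᵢ[𝕜] lp (fun i => StrongDual 𝕜 (F i)) 1) :=
  nonempty_linearIsometryEquiv_of_contractive S.pairing
    (fun f => LinearMap.mkContinuous_norm_le _ (norm_nonneg f) (S.norm_tsum_apply_p_le f))
    S.pairing_eq_zero
    S.exists_pairing_eq

end CoordinateSystem

end DualOfCoordinateSystem

/-! ### The space of convergent sequences -/

section ConvergentSequences

variable {𝕜 : Type*} [RCLike 𝕜]

theorem convSeq_norm_apply_le (x : convSeq 𝕜) (n : ℕ) : ‖x.1 n‖ ≤ ‖x‖ :=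
  x.1.norm_coe_le_norm n

theorem convSeq_norm_le {x : convSeq 𝕜} {r : ℝ} (hr : 0 ≤ r) (h : ∀ n, ‖x.1 n‖ ≤ r) : ‖x‖ ≤ r :=
  (BoundedContinuousFunction.norm_le hr).2 h

theorem norm_seqLim_le (x : convSeq 𝕜) : ‖seqLim x‖ ≤ ‖x‖ :=
  le_of_tendsto' (tendsto_seqLim x).norm (convSeq_norm_apply_le x)

theorem seqLim_eq {x : convSeq 𝕜} {l : 𝕜} (h : Tendsto (fun n => x.1 n) atTop (𝓝 l)) :
    seqLim x = l :=
  tendsto_nhds_unique (tendsto_seqLim x) h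

variable (𝕜) in
/-- The `n`-th term of a convergent sequence as a continuous linear functional. -/
noncomputable def seqEvalCLM (n : ℕ) : StrongDual 𝕜 (convSeq 𝕜) :=
  LinearMap.mkContinuous
    { toFun := fun x => x.1 n
      map_add' := fun _ _ => rfl
      map_smul' := fun _ _ => rfl } 1 fun x => by
    rw [one_mul]
    exact convSeq_norm_apply_le x n

variable (𝕜) in
/-- The limit of a convergent sequence as a continuous linear functional. -/
noncomputable def seqLimCLM : StrongDual 𝕜 (convSeq 𝕜) :=
  LinearMap.mkContinuous
    { toFun := seqLim
      map_add' := fun x y => seqLim_eq ((tendsto_seqLim x).add (tendsto_seqLim y))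
      map_smul' := fun c x => seqLim_eq ((tendsto_seqLim x).const_mul c) } 1 fun x => by
    rw [one_mul]
    exact norm_seqLim_le x

@[simp]
theorem seqEvalCLM_apply (n : ℕ) (x : convSeq 𝕜) : seqEvalCLM 𝕜 n x = x.1 n := rfl

@[simp]
theorem seqLimCLM_apply (x : convSeq 𝕜) : seqLimCLM 𝕜 x = seqLim x := rfl

theorem isClosed_convSeq : IsClosed (convSeq 𝕜 : Set (ℕ →ᵇ 𝕜)) := by
  refine isClosed_of_closure_subset fun x hx => ?_
  refine cauchySeq_tendsto_of_complete (Metric.cauchySeq_iff'.2 fun ε hε => ?_)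
  obtain ⟨y, hy, hxy⟩ := Metric.mem_closure_iff.1 hx (ε / 3) (by positivity)
  obtain ⟨l, hl⟩ := hy
  obtain ⟨N, hN⟩ := Metric.cauchySeq_iff'.1 hl.cauchySeq (ε / 3) (by positivity)
  refine ⟨N, fun n hn => ?_⟩
  have h1 := (BoundedContinuousFunction.dist_coe_le_dist (f := x) (g := y) n).trans_lt hxy
  have h2 := (BoundedContinuousFunction.dist_coe_le_dist (f := x) (g := y) N).trans_lt hxy
  rw [dist_comm] at h2
  linarith [hN n hn, dist_triangle4 (x n) (y n) (y N) (x N)]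

instance : CompleteSpace (convSeq 𝕜) := isClosed_convSeq.completeSpace_coe

instance : CompleteSpace (spaceX₁ 𝕜) := by
  have h : (spaceX₁ 𝕜 : Set (Fin 3 → convSeq 𝕜)) =
      {w | seqLimCLM 𝕜 (w 0) + seqLimCLM 𝕜 (w 1) + seqLimCLM 𝕜 (w 2) = 0} := rfl
  exact (h ▸ isClosed_eq (by fun_prop) continuous_const :
    IsClosed (spaceX₁ 𝕜 : Set (Fin 3 → convSeq 𝕜))).completeSpace_coe

instance : CompleteSpace (spaceX₂ 𝕜) := by
  have h : (spaceX₂ 𝕜 : Set (Fin 3 → convSeq 𝕜)) =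
      {w | seqEvalCLM 𝕜 0 (w 0) + seqEvalCLM 𝕜 0 (w 1) + seqEvalCLM 𝕜 0 (w 2) = 0} := rfl
  exact (h ▸ isClosed_eq (by fun_prop) continuous_const :
    IsClosed (spaceX₂ 𝕜 : Set (Fin 3 → convSeq 𝕜))).completeSpace_coe

variable (𝕜) in
/-- The sequence whose `n`-th term is one and whose other terms vanish. -/
noncomputable def unitSeq (n : ℕ) : convSeq 𝕜 :=
  ⟨BoundedContinuousFunction.ofNormedAddCommGroupDiscrete (Pi.single n 1) 1 fun m => by
    by_cases h : m = n
    · subst h; simp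
    · simp [Pi.single_eq_of_ne h], 0, by
    refine tendsto_const_nhds.congr' ?_
    filter_upwards [eventually_gt_atTop n] with m hm
    exact (Pi.single_eq_of_ne (M := fun _ => 𝕜) hm.ne' (1 : 𝕜)).symm⟩

variable (𝕜) in
/-- The constant sequence one. -/
noncomputable def oneSeq : convSeq 𝕜 := ⟨1, 1, tendsto_const_nhds⟩

theorem unitSeq_apply_self (n : ℕ) : (unitSeq 𝕜 n).1 n = 1 :=
  Pi.single_eq_same (M := fun _ => 𝕜) n 1

theorem unitSeq_apply_ne {n m : ℕ} (h : m ≠ n) : (unitSeq 𝕜 n).1 m = 0 :=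
  Pi.single_eq_of_ne (M := fun _ => 𝕜) h 1

@[simp]
theorem seqLim_unitSeq (n : ℕ) : seqLim (unitSeq 𝕜 n) = 0 := by
  refine seqLim_eq (tendsto_const_nhds.congr' ?_)
  filter_upwards [eventually_gt_atTop n] with m hm
  exact (unitSeq_apply_ne hm.ne').symm

@[simp]
theorem oneSeq_apply (n : ℕ) : (oneSeq 𝕜).1 n = 1 := rfl

@[simp]
theorem seqLim_oneSeq : seqLim (oneSeq 𝕜) = 1 := seqLim_eq tendsto_const_nhds

end ConvergentSequences

/-! ### From scalar coordinates to subspaces of finite powers -/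

section Tensor

variable {𝕜 : Type*} [RCLike 𝕜] {J C I : Type*} [Fintype J] [NormedAddCommGroup C]
  [NormedSpace 𝕜 C]

/-- The vector valued version of a functional on `C`, applied componentwise. -/
noncomputable def componentwise (J : Type*) [Fintype J] (χ : StrongDual 𝕜 C) :
    (J → C) →L[𝕜] (J → 𝕜) :=
  ContinuousLinearMap.pi fun j => χ.comp (ContinuousLinearMap.proj j)

@[simp]
theorem componentwise_apply (χ : StrongDual 𝕜 C) (w : J → C) (j : J) :
    componentwise J χ w j = χ (w j) := rfl

/-- The elementary tensors with second factor `c`. -/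
noncomputable def tensorRight (𝕜 : Type*) [RCLike 𝕜] [NormedSpace 𝕜 C] (J : Type*) [Fintype J]
    (c : C) : (J → 𝕜) →L[𝕜] (J → C) :=
  ContinuousLinearMap.pi fun j =>
    (ContinuousLinearMap.toSpanSingleton 𝕜 c).comp (ContinuousLinearMap.proj j)

@[simp]
theorem tensorRight_apply (c : C) (e : J → 𝕜) (j : J) : tensorRight 𝕜 J c e j = e j • c := rfl

theorem componentwise_tensorRight (χ : StrongDual 𝕜 C) (c : C) (e : J → 𝕜) :
    componentwise J χ (tensorRight 𝕜 J c e) = χ c • e := by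
  ext j
  simp [mul_comm]

/-- A scalar coordinate system on `C` yields one on each subspace of `J → C` that is cut out by
coordinatewise conditions. -/
noncomputable def CoordinateSystem.ofScalar (W : Submodule 𝕜 (J → C))
    (F : I → Submodule 𝕜 (J → 𝕜)) (o : I) (χ : I → StrongDual 𝕜 C) (u : I → C) (v : C)
    (hW : ∀ w, w ∈ W ↔ ∀ i, componentwise J (χ i) w ∈ F i)
    (norm_χ_le : ∀ i c, ‖χ i c‖ ≤ ‖c‖)
    (norm_le : ∀ c r, 0 ≤ r → (∀ i, ‖χ i c‖ ≤ r) → ‖c‖ ≤ r)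
    (χ_u_ne : ∀ i j, j ≠ i → χ j (u i) = 0) (χ_u_self : ∀ i, i ≠ o → χ i (u i) = 1)
    (u_base : u o = 0) (χ_v : χ o v = 1) (norm_χ_v_le : ∀ i, ‖χ i v‖ ≤ 1)
    (tendsto_zero : ∀ c, χ o c = 0 → Tendsto (fun i => ‖χ i c‖) cofinite (𝓝 0))
    (hF : ∀ i, ∀ e ∈ F o, χ i v • e ∈ F i) :
    CoordinateSystem 𝕜 W (fun i => F i) o where
  p i := ((componentwise J (χ i)).comp W.subtypeL).codRestrict (F i) fun w => (hW w.1).1 w.2 i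
  κ i := ((tensorRight 𝕜 J (u i)).comp (F i).subtypeL).codRestrict W fun e => by
    refine (hW _).2 fun j => ?_
    rw [ContinuousLinearMap.comp_apply, componentwise_tensorRight]
    by_cases hj : j = i
    · subst hj
      exact (F j).smul_mem _ e.2
    · rw [χ_u_ne i j hj, zero_smul]
      exact (F j).zero_mem
  τ := ((tensorRight 𝕜 J v).comp (F o).subtypeL).codRestrict W fun e => by
    refine (hW _).2 fun j => ?_
    rw [ContinuousLinearMap.comp_apply, componentwise_tensorRight]
    exact hF j _ e.2
  norm_p_le i w := (pi_norm_le_iff_of_nonneg (norm_nonneg w)).2 fun j =>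
    (norm_χ_le i _).trans (norm_le_pi_norm w.1 j)
  norm_le w r hr h := (pi_norm_le_iff_of_nonneg hr).2 fun j => norm_le _ r hr fun i =>
    (norm_le_pi_norm (componentwise J (χ i) w.1) j).trans (h i)
  p_κ_ne i j e hj := Subtype.ext ((componentwise_tensorRight _ _ _).trans
    (by rw [χ_u_ne i j hj, zero_smul]; rfl))
  p_κ_self i e hi := Subtype.ext ((componentwise_tensorRight _ _ _).trans
    (by rw [χ_u_self i hi, one_smul]; rfl))
  κ_base e := by
    ext j
    change (e.1 j) • u o = 0
    rw [u_base, smul_zero]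
  p_τ e := Subtype.ext ((componentwise_tensorRight _ _ _).trans
    (by rw [χ_v, one_smul]; rfl))
  norm_p_τ_le i e := by
    change ‖componentwise J (χ i) (tensorRight 𝕜 J v e.1)‖ ≤ ‖e.1‖
    rw [componentwise_tensorRight, norm_smul]
    exact mul_le_of_le_one_left (norm_nonneg _) (norm_χ_v_le i)
  tendsto_zero w hw := by
    have h : Tendsto (fun i => ∑ j, ‖χ i (w.1 j)‖) cofinite (𝓝 0) := by
      rw [← Finset.sum_const_zero (s := (Finset.univ : Finset J))]
      exact tendsto_finsetSum _ fun j _ =>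
        tendsto_zero _ (congrFun (congrArg Subtype.val hw) j)
    refine squeeze_zero (fun _ => norm_nonneg _) (fun i => ?_) h
    exact (pi_norm_le_iff_of_nonneg (Finset.sum_nonneg fun _ _ => norm_nonneg _)).2 fun j =>
      Finset.single_le_sum (f := fun j => ‖χ i (w.1 j)‖) (fun _ _ => norm_nonneg _)
        (Finset.mem_univ j)

end Tensor

/-! ### Coordinate systems on the two preduals -/

section Preduals

variable (𝕜 : Type*) [RCLike 𝕜]

/-- The coordinate spaces common to `X₁` and `X₂`. -/
def coordSpace : Option ℕ → Submodule 𝕜 (Fin 3 → 𝕜)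
  | none => hexSpace 𝕜
  | some _ => ⊤

theorem tendsto_cofinite_option {f : Option ℕ → ℝ}
    (h : Tendsto (fun n => f (some n)) atTop (𝓝 0)) : Tendsto f cofinite (𝓝 0) := by
  rw [← Nat.cofinite_eq_atTop] at h
  intro s hs
  have h' : {n | f (some n) ∉ s}.Finite := h hs
  refine ((h'.image some).insert none).subset fun i hi => ?_
  cases i with
  | none => exact Set.mem_insert _ _
  | some n => exact Set.mem_insert_of_mem _ ⟨n, hi, rfl⟩

/-- The coordinates of `X₁`: limits and terms. -/
noncomputable def coordSystemX₁ :
    CoordinateSystem 𝕜 (spaceX₁ 𝕜) (fun i => coordSpace 𝕜 i) none :=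
  CoordinateSystem.ofScalar (spaceX₁ 𝕜) (coordSpace 𝕜) none
    (fun i => i.elim (seqLimCLM 𝕜) (seqEvalCLM 𝕜)) (fun i => i.elim 0 (unitSeq 𝕜)) (oneSeq 𝕜)
    (fun w => ⟨fun h i => by
        cases i with
        | none => exact h
        | some n => exact Submodule.mem_top, fun h => h none⟩)
    (fun i c => by
      cases i with
      | none => exact norm_seqLim_le c
      | some n => exact convSeq_norm_apply_le c n)
    (fun c r hr h => convSeq_norm_le hr fun n => h (some n))
    (fun i j hij => by
      rcases i with _ | n <;> rcases j with _ | m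
      · exact absurd rfl hij
      · rfl
      · exact seqLim_unitSeq n
      · exact unitSeq_apply_ne fun h => hij (congrArg some h))
    (fun i hi => by
      rcases i with _ | n
      · exact absurd rfl hi
      · exact unitSeq_apply_self n)
    rfl seqLim_oneSeq
    (fun i => by rcases i with _ | n <;> simp)
    (fun c hc => tendsto_cofinite_option (by
      have h := (tendsto_seqLim c).norm
      rw [show seqLim c = 0 from hc, norm_zero] at h
      exact h))
    (fun i e he => by
      rcases i with _ | n
      · exact Submodule.smul_mem _ _ he
      · exact Submodule.mem_top)

/-- The scalar functionals giving the coordinates of `X₂`: the first term, the limit and the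
remaining terms. -/
noncomputable def scalarCoordX₂ : Option ℕ → StrongDual 𝕜 (convSeq 𝕜)
  | none => seqEvalCLM 𝕜 0
  | some 0 => seqLimCLM 𝕜
  | some (n + 1) => seqEvalCLM 𝕜 (n + 1)

/-- The vectors biorthogonal to the terms in `scalarCoordX₂`. -/
noncomputable def unitVectorX₂ : Option ℕ → convSeq 𝕜
  | none => unitSeq 𝕜 0
  | some 0 => 0
  | some (n + 1) => unitSeq 𝕜 (n + 1)

theorem seqLim_oneSeq_sub_unitSeq : seqLim (oneSeq 𝕜 - unitSeq 𝕜 0) = 1 := by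
  change seqLimCLM 𝕜 (oneSeq 𝕜 - unitSeq 𝕜 0) = 1
  rw [map_sub]
  simp

theorem oneSeq_sub_unitSeq_apply_zero : (oneSeq 𝕜 - unitSeq 𝕜 0).1 0 = 0 := by
  change (oneSeq 𝕜).1 0 - (unitSeq 𝕜 0).1 0 = 0
  rw [unitSeq_apply_self, oneSeq_apply, sub_self]

theorem oneSeq_sub_unitSeq_apply_succ (n : ℕ) : (oneSeq 𝕜 - unitSeq 𝕜 0).1 (n + 1) = 1 := by
  change (oneSeq 𝕜).1 (n + 1) - (unitSeq 𝕜 0).1 (n + 1) = 1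
  rw [unitSeq_apply_ne n.succ_ne_zero, oneSeq_apply, sub_zero]

/-- The coordinates of `X₂`: first terms, limits and the remaining terms. -/
noncomputable def coordSystemX₂ :
    CoordinateSystem 𝕜 (spaceX₂ 𝕜) (fun i => coordSpace 𝕜 i) (some 0) :=
  CoordinateSystem.ofScalar (spaceX₂ 𝕜) (coordSpace 𝕜) (some 0)
    -- The limit now ranges over all of `Fin 3 → 𝕜`, so its lift must have zero first term in order
    -- to satisfy the constraint of `X₂`.
    (scalarCoordX₂ 𝕜) (unitVectorX₂ 𝕜) (oneSeq 𝕜 - unitSeq 𝕜 0)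
    (fun w => ⟨fun h i => by
        cases i with
        | none => exact h
        | some n => exact Submodule.mem_top, fun h => h none⟩)
    (fun i c => by
      rcases i with _ | _ | n
      · exact convSeq_norm_apply_le c 0
      · exact norm_seqLim_le c
      · exact convSeq_norm_apply_le c (n + 1))
    (fun c r hr h => convSeq_norm_le hr fun n => by
      rcases n with _ | n
      · exact h none
      · exact h (some (n + 1)))
    (fun i j hij => by
      rcases i with _ | _ | n <;> rcases j with _ | _ | m
      · exact absurd rfl hij
      · exact seqLim_unitSeq 0
      · exact unitSeq_apply_ne m.succ_ne_zero
      · rfl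
      · exact absurd rfl hij
      · rfl
      · exact unitSeq_apply_ne n.succ_ne_zero.symm
      · exact seqLim_unitSeq (n + 1)
      · exact unitSeq_apply_ne fun h => hij (congrArg some h))
    (fun i hi => by
      rcases i with _ | _ | n
      · exact unitSeq_apply_self 0
      · exact absurd rfl hi
      · exact unitSeq_apply_self (n + 1))
    rfl (seqLim_oneSeq_sub_unitSeq 𝕜)
    (fun i => by
      rcases i with _ | _ | n
      · exact ((congrArg norm (oneSeq_sub_unitSeq_apply_zero 𝕜)).trans norm_zero).trans_le
          zero_le_one
      · exact ((congrArg norm (seqLim_oneSeq_sub_unitSeq 𝕜)).trans norm_one).le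
      · exact ((congrArg norm (oneSeq_sub_unitSeq_apply_succ 𝕜 n)).trans norm_one).le)
    (fun c hc => tendsto_cofinite_option (by
      have h := (tendsto_seqLim c).norm
      rw [show seqLim c = 0 from hc, norm_zero] at h
      refine h.congr' ?_
      -- The coordinate at `some 0` is the limit, so coordinates and terms agree only from index 1
      -- on.
      filter_upwards [eventually_gt_atTop 0] with n hn
      obtain ⟨m, rfl⟩ := Nat.exists_eq_succ_of_ne_zero hn.ne'
      rfl))
    (fun i e _ => by
      rcases i with _ | n
      · have h : scalarCoordX₂ 𝕜 none (oneSeq 𝕜 - unitSeq 𝕜 0) = 0 :=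
          oneSeq_sub_unitSeq_apply_zero 𝕜
        rw [h, zero_smul]
        exact Submodule.zero_mem _
      · exact Submodule.mem_top)

end Preduals

/-! ### Numerical radius and numerical index -/

section NumericalIndex

variable {𝕜 : Type u} [RCLike 𝕜] {X : Type v} [NormedAddCommGroup X] [NormedSpace 𝕜 X]

theorem norm_le_of_mem_numericalRange {T : X →L[𝕜] X} {a : 𝕜} (ha : a ∈ numericalRange 𝕜 T) :
    ‖a‖ ≤ ‖T‖ := by
  obtain ⟨x, f, hx, hf, -, rfl⟩ := ha
  calc ‖f (T x)‖ ≤ ‖f‖ * (‖T‖ * ‖x‖) := f.le_opNorm_of_le (T.le_opNorm x)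
    _ = ‖T‖ := by rw [hf, hx, one_mul, mul_one]

theorem numericalRadius_nonneg (T : X →L[𝕜] X) : 0 ≤ numericalRadius 𝕜 T := by
  refine Real.sSup_nonneg ?_
  rintro _ ⟨a, -, rfl⟩
  exact norm_nonneg a

theorem le_numericalRadius {T : X →L[𝕜] X} {x : X} {f : StrongDual 𝕜 X} (hx : ‖x‖ = 1)
    (hf : ‖f‖ = 1) (hfx : f x = 1) : ‖f (T x)‖ ≤ numericalRadius 𝕜 T := by
  refine le_csSup ⟨‖T‖, ?_⟩ ⟨_, ⟨x, f, hx, hf, hfx, rfl⟩, rfl⟩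
  rintro _ ⟨a, ha, rfl⟩
  exact norm_le_of_mem_numericalRange ha

theorem numericalRadius_le {T : X →L[𝕜] X} {C : ℝ} (hC : 0 ≤ C)
    (h : ∀ (x : X) (f : StrongDual 𝕜 X), ‖x‖ = 1 → ‖f‖ = 1 → f x = 1 → ‖f (T x)‖ ≤ C) :
    numericalRadius 𝕜 T ≤ C := by
  refine Real.sSup_le ?_ hC
  rintro _ ⟨_, ⟨x, f, hx, hf, hfx, rfl⟩, rfl⟩
  exact h x f hx hf hfx

theorem numericalRadius_le_norm (T : X →L[𝕜] X) : numericalRadius 𝕜 T ≤ ‖T‖ :=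
  numericalRadius_le (norm_nonneg T) fun x f hx hf hfx =>
    norm_le_of_mem_numericalRange ⟨x, f, hx, hf, hfx, rfl⟩

theorem numericalIndex_le {T : X →L[𝕜] X} (hT : ‖T‖ = 1) :
    numericalIndex 𝕜 X ≤ numericalRadius 𝕜 T := by
  refine csInf_le ⟨0, ?_⟩ ⟨T, hT, rfl⟩
  rintro _ ⟨S, -, rfl⟩
  exact numericalRadius_nonneg S

theorem exists_norm_eq_one_add_mul (a b : 𝕜) :
    ∃ z : 𝕜, ‖z‖ = 1 ∧ ‖a + z * b‖ = ‖a‖ + ‖b‖ := by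
  obtain ⟨c, hc, hca⟩ := RCLike.exists_norm_mul_eq_self a
  obtain ⟨d, hd, hdb⟩ := RCLike.exists_norm_eq_mul_self b
  refine ⟨c * d, by rw [norm_mul, hc, hd, mul_one], ?_⟩
  rw [mul_assoc, ← hdb]
  nth_rewrite 1 [← hca]
  rw [← mul_add, norm_mul, hc, one_mul, ← RCLike.ofReal_add, RCLike.norm_ofReal,
    abs_of_nonneg (by positivity)]

/-- Norm and numerical radius agree when the norm is the supremum of the moduli of coordinates
each of which can be changed independently of the others. -/
theorem norm_le_numericalRadius_of_coordinates {K : Type*} (δ : K → StrongDual 𝕜 X) (e : K → X)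
    (hδ : ∀ k x, ‖δ k x‖ ≤ ‖x‖) (norm_le : ∀ x r, 0 ≤ r → (∀ k, ‖δ k x‖ ≤ r) → ‖x‖ ≤ r)
    (δ_self : ∀ k, δ k (e k) = 1) (δ_ne : ∀ k l, l ≠ k → δ l (e k) = 0) (T : X →L[𝕜] X) :
    ‖T‖ ≤ numericalRadius 𝕜 T := by
  by_contra! hlt
  obtain ⟨x, hx, hTx⟩ := T.exists_lt_apply_of_lt_opNorm hlt
  obtain ⟨k, hk⟩ : ∃ k, numericalRadius 𝕜 T < ‖δ k (T x)‖ := by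
    by_contra! h
    exact hTx.not_ge (norm_le _ _ (numericalRadius_nonneg T) h)
  -- Replacing the `k`-th coordinate of `x` by a unimodular `z` gives a norm-one vector supported by
  -- `z⁻¹ • δ k`; this `z` aligns the two contributions to `δ k ∘ T`, so the value does not drop
  -- below `‖δ k (T x)‖`.
  obtain ⟨z, hz, hza⟩ := exists_norm_eq_one_add_mul (δ k (T (x - δ k x • e k))) (δ k (T (e k)))
  set y := (x - δ k x • e k) + z • e k with hy
  have hz0 : z ≠ 0 := norm_ne_zero_iff.1 (by rw [hz]; exact one_ne_zero)
  have hδy : δ k y = z := by simp [hy, δ_self]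
  have hy1 : ‖y‖ = 1 := by
    refine le_antisymm (norm_le _ 1 zero_le_one fun l => ?_) (by rw [← hz, ← hδy]; exact hδ k y)
    by_cases hl : l = k
    · subst hl
      rw [hδy, hz]
    · have : δ l y = δ l x := by simp [hy, δ_ne k l hl]
      rw [this]
      exact (hδ l x).trans hx.le
  have hg1 : (z⁻¹ • δ k) y = 1 := by simp [hδy, hz0]
  have hg : ‖z⁻¹ • δ k‖ = 1 := by
    refine le_antisymm (ContinuousLinearMap.opNorm_le_bound _ zero_le_one fun w => ?_) ?_
    · simpa [norm_smul, hz] using hδ k w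
    · have := (z⁻¹ • δ k).le_opNorm y
      rwa [hg1, hy1, mul_one, norm_one] at this
  have h1 : ‖(z⁻¹ • δ k) (T y)‖ = ‖δ k (T (x - δ k x • e k))‖ + ‖δ k (T (e k))‖ := by
    rw [← hza]
    simp [hz, hy]
  have h2 : ‖δ k (T x)‖ ≤ ‖δ k (T (x - δ k x • e k))‖ + ‖δ k (T (e k))‖ := by
    have h3 : δ k (T x) = δ k (T (x - δ k x • e k)) + δ k x * δ k (T (e k)) := by
      simp
    rw [h3]
    refine (norm_add_le _ _).trans (add_le_add_right ?_ _)
    rw [norm_mul]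
    exact mul_le_of_le_one_left (norm_nonneg _) ((hδ k x).trans hx.le)
  have h4 := le_numericalRadius (T := T) hy1 hg hg1
  linarith

theorem numericalIndex_eq_one [Nontrivial X]
    (h : ∀ T : X →L[𝕜] X, ‖T‖ ≤ numericalRadius 𝕜 T) : numericalIndex 𝕜 X = 1 := by
  have hid : ‖ContinuousLinearMap.id 𝕜 X‖ = 1 := ContinuousLinearMap.norm_id
  refine le_antisymm ?_ (le_csInf ⟨_, _, hid, rfl⟩ ?_)
  · exact (numericalIndex_le hid).trans ((numericalRadius_le_norm _).trans hid.le)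
  · rintro _ ⟨T, hT, rfl⟩
    exact (show ‖T‖ = 1 from hT).symm.le.trans (h T)

/-- Since `1 - re r ≤ ‖1 - r‖ ≤ 1 - ‖r‖`, the real part of `r` is at least its modulus. -/
theorem eq_norm_of_norm_add_norm_one_sub_le {r : 𝕜} (h : ‖r‖ + ‖1 - r‖ ≤ 1) : r = (‖r‖ : 𝕜) := by
  have h1 := RCLike.re_le_norm (1 - r)
  rw [map_sub, RCLike.one_re] at h1
  exact RCLike.norm_le_re_iff_eq_norm.1 (by linarith [RCLike.re_le_norm r])

/-- The numerical index does not exceed that of a nonzero M-summand. -/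
theorem IsometricToMSummand.numericalIndex_le {H : Type v} [NormedAddCommGroup H]
    [NormedSpace 𝕜 H] [Nontrivial H] (h : IsometricToMSummand 𝕜 H X) :
    numericalIndex 𝕜 X ≤ numericalIndex 𝕜 H := by
  obtain ⟨J, ⟨P, hP, rfl⟩, ⟨E⟩⟩ := h
  have hM : ∀ x, ‖x‖ = max ‖P x‖ ‖x - P x‖ := hP.Mnorm
  have hPP : ∀ x, P (P x) = P x := fun x => DFunLike.congr_fun hP.proj x
  let ι : H →L[𝕜] X := (Submodule.subtypeL _).comp (E : H →L[𝕜] LinearMap.range (P : X →ₗ[𝕜] X))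
  let p : X →L[𝕜] H := (E.symm : LinearMap.range (P : X →ₗ[𝕜] X) →L[𝕜] H).comp
    (P.codRestrict _ fun x => LinearMap.mem_range_self (P : X →ₗ[𝕜] X) x)
  have hι : ∀ y, ‖ι y‖ = ‖y‖ := fun y => E.norm_map y
  have hιp : ∀ x, ι (p x) = P x := fun x => congrArg Subtype.val (E.apply_symm_apply _)
  have hp : ∀ x, ‖p x‖ = ‖P x‖ := fun x => by rw [← hιp, hι]
  have hPι : ∀ y, P (ι y) = ι y := fun y => by
    obtain ⟨x, hx⟩ := (E y).2
    change P (E y).1 = (E y).1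
    rw [← hx]
    exact hPP x
  have hpι : ∀ y, p (ι y) = y := fun y => by
    refine E.injective (Subtype.ext ?_)
    change ι (p (ι y)) = ι y
    rw [hιp, hPι]
  refine le_csInf ⟨_, _, ContinuousLinearMap.norm_id (𝕜 := 𝕜) (E := H), rfl⟩ ?_
  rintro _ ⟨T, hT : ‖T‖ = 1, rfl⟩
  -- An operator on the summand is extended by zero on the complement; it remains to bound the
  -- numerical radius of this extension by that of `T`.
  have hT' : ‖ι.comp (T.comp p)‖ = 1 := by
    refine le_antisymm (ContinuousLinearMap.opNorm_le_bound _ zero_le_one fun x => ?_) ?_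
    · change ‖ι (T (p x))‖ ≤ _
      rw [hι, ← hT]
      refine T.le_opNorm_of_le ?_
      rw [hp, hM x]
      exact le_max_left _ _
    · rw [← hT]
      refine ContinuousLinearMap.opNorm_le_bound _ (norm_nonneg _) fun y => ?_
      have := (ι.comp (T.comp p)).le_opNorm (ι y)
      rwa [hι, show ι.comp (T.comp p) (ι y) = ι (T (p (ι y))) from rfl, hι, hpι] at this
  refine (_root_.numericalIndex_le hT').trans
    (numericalRadius_le (numericalRadius_nonneg T) fun w f hw hf hfw => ?_)
  change ‖(f.comp ι) (T (p w))‖ ≤ _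
  have hwP : max ‖P w‖ ‖w - P w‖ = 1 := (hM w).symm.trans hw
  set q := f.comp ι with hq
  have hr : f (w - P w) = 1 - q (p w) := by
    rw [map_sub, hfw, ← hιp]
    rfl
  -- The M-norm allows any unit-ball vector of the summand to be combined with a rotated `w - P w`.
  -- Together with `f w = 1` this forces `q (p w) = ‖q‖`.
  have hq1 : ∀ y, ‖y‖ ≤ 1 → ‖q y‖ + ‖f (w - P w)‖ ≤ 1 := by
    intro y hy
    obtain ⟨z, hz, hzq⟩ := exists_norm_eq_one_add_mul (q y) (f (w - P w))
    have hn : ‖ι y + z • (w - P w)‖ ≤ 1 := by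
      have h1 : P (ι y + z • (w - P w)) = ι y := by
        rw [map_add, map_smul, map_sub, hPP, sub_self, smul_zero, add_zero, hPι]
      rw [hM, h1, add_sub_cancel_left, hι, norm_smul, hz, one_mul]
      exact max_le hy ((le_max_right _ _).trans hwP.le)
    rw [← hzq]
    have h2 : q y + z * f (w - P w) = f (ι y + z • (w - P w)) := by simp [hq]
    rw [h2]
    exact (f.le_opNorm _).trans (by rw [hf, one_mul]; exact hn)
  have hpw : ‖p w‖ ≤ 1 := by
    rw [hp]
    exact (le_max_left _ _).trans hwP.le
  have hqr : q (p w) = (‖q (p w)‖ : 𝕜) :=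
    eq_norm_of_norm_add_norm_one_sub_le (by rw [← hr]; exact hq1 _ hpw)
  have h3 : 1 - ‖q (p w)‖ ≤ ‖f (w - P w)‖ := by
    rw [hr]
    simpa using norm_sub_norm_le (1 : 𝕜) (q (p w))
  have hqn : ‖q‖ = ‖q (p w)‖ := by
    refine le_antisymm ?_ ((q.le_opNorm _).trans (mul_le_of_le_one_right (norm_nonneg _) hpw))
    by_contra! hlt
    obtain ⟨y, hy, hqy⟩ := q.exists_lt_apply_of_lt_opNorm hlt
    linarith [hq1 y hy.le]
  -- Unless `q` vanishes, `q / ‖q‖` is a norm-one functional supporting the ball of `H` at `p w`,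
  -- and scaling back by `‖q‖ ≤ 1` only lowers the value.
  by_cases hq0 : ‖q‖ = 0
  · rw [norm_eq_zero.1 hq0]
    simpa using numericalRadius_nonneg T
  · have hpos : 0 < ‖q‖ := lt_of_le_of_ne (norm_nonneg _) (Ne.symm hq0)
    have hpw1 : ‖p w‖ = 1 := by
      refine le_antisymm hpw ?_
      have := q.le_opNorm (p w)
      rw [← hqn] at this
      exact le_of_mul_le_mul_left (by rwa [mul_one]) hpos
    have hc : (‖q‖ : 𝕜) ≠ 0 := RCLike.ofReal_ne_zero.2 hq0
    have h5 := le_numericalRadius (T := T) (f := (‖q‖ : 𝕜)⁻¹ • q) hpw1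
      (by rw [norm_smul, norm_inv, RCLike.norm_ofReal, abs_norm, inv_mul_cancel₀ hq0])
      (by rw [smul_apply, hqr, ← hqn, smul_eq_mul, inv_mul_cancel₀ hc])
    rw [smul_apply, smul_eq_mul, norm_mul, norm_inv, RCLike.norm_ofReal,
      abs_norm, inv_mul_le_iff₀ hpos] at h5
    refine h5.trans (mul_le_of_le_one_left (numericalRadius_nonneg T) ?_)
    rw [hqn]
    linarith [hq1 _ hpw, norm_nonneg (f (w - P w))]

/-- Every coordinate space of a coordinate system other than the distinguished one is an
M-summand. -/
theorem CoordinateSystem.isometricToMSummand {I : Type*} {F : I → Type v}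
    [∀ i, NormedAddCommGroup (F i)] [∀ i, NormedSpace 𝕜 (F i)] {o : I}
    (S : CoordinateSystem 𝕜 X F o) {i : I} (hi : i ≠ o) : IsometricToMSummand 𝕜 (F i) X := by
  have hκ : ∀ e, ‖S.κ i e‖ = ‖e‖ := by
    intro e
    refine le_antisymm (S.norm_le _ _ (norm_nonneg e) fun j => ?_) ?_
    · by_cases hj : j = i
      · subst hj
        rw [S.p_κ_self j e hi]
      · rw [S.p_κ_ne i j e hj, norm_zero]
        exact norm_nonneg e
    · conv_lhs => rw [← S.p_κ_self i e hi]
      exact S.norm_p_le i _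
  let κ : F i →ₗᵢ[𝕜] X := ⟨(S.κ i : F i →ₗ[𝕜] X), hκ⟩
  refine ⟨LinearMap.range κ.toLinearMap, ⟨(S.κ i).comp (S.p i), ⟨?_, fun x => ?_⟩, ?_⟩,
    ⟨κ.equivRange⟩⟩
  · ext x
    change S.κ i (S.p i (S.κ i (S.p i x))) = S.κ i (S.p i x)
    rw [S.p_κ_self i _ hi]
  · change ‖x‖ = max ‖S.κ i (S.p i x)‖ ‖x - S.κ i (S.p i x)‖
    have hself : S.p i (x - S.κ i (S.p i x)) = 0 := by
      rw [map_sub, S.p_κ_self i _ hi, sub_self]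
    have hne : ∀ j, j ≠ i → S.p j (x - S.κ i (S.p i x)) = S.p j x := fun j hj => by
      rw [map_sub, S.p_κ_ne i j _ hj, sub_zero]
    rw [hκ]
    refine le_antisymm (S.norm_le _ _ (le_max_of_le_left (norm_nonneg _)) fun j => ?_)
      (max_le (S.norm_p_le i x) (S.norm_le _ _ (norm_nonneg x) fun j => ?_))
    · by_cases hj : j = i
      · subst hj
        exact le_max_left _ _
      · rw [← hne j hj]
        exact (S.norm_p_le j _).trans (le_max_right _ _)
    · by_cases hj : j = i
      · subst hj
        rw [hself, norm_zero]
        exact norm_nonneg x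
      · rw [hne j hj]
        exact S.norm_p_le j x
  · ext y
    constructor
    · rintro ⟨x, rfl⟩
      exact ⟨S.p i x, rfl⟩
    · rintro ⟨e, rfl⟩
      exact ⟨S.κ i e, congrArg (S.κ i) (S.p_κ_self i e hi)⟩

/-- Norm-one functionals on subspaces of `ℓ_∞^J` supporting the unit ball at `x` only see the
coordinates at which `x` has modulus one. -/
theorem norm_apply_le_of_support {J : Type*} [Fintype J] {W : Submodule 𝕜 (J → 𝕜)} {x y : W}
    {f : StrongDual 𝕜 W} (hx : ‖x‖ = 1) (hf : ‖f‖ = 1) (hfx : f x = 1) {C : ℝ}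
    (h : ∀ j, ‖x.1 j‖ = 1 → ‖y.1 j‖ ≤ C) (hC : 0 ≤ C) : ‖f y‖ ≤ C := by
  classical
  obtain ⟨g, hgf, hg⟩ := exists_extension_norm_eq W f
  set c : J → 𝕜 := fun j => g (Pi.single j 1) with hc
  have hsum : ∀ w : J → 𝕜, g w = ∑ j, w j * c j := by
    intro w
    conv_lhs => rw [pi_eq_sum_univ' w]
    rw [map_sum]
    refine Finset.sum_congr rfl fun j _ => ?_
    rw [map_smul, smul_eq_mul]
  have hc1 : ∑ j, ‖c j‖ ≤ 1 := by
    choose t ht htc using fun j => RCLike.exists_norm_eq_mul_self (c j)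
    have h1 : g t = ((∑ j, ‖c j‖ : ℝ) : 𝕜) := by
      rw [hsum]
      push_cast
      exact Finset.sum_congr rfl fun j _ => (htc j).symm
    have h2 := g.le_opNorm t
    have h3 : ‖t‖ ≤ 1 := (pi_norm_le_iff_of_nonneg zero_le_one).2 fun j => (ht j).le
    rw [h1, RCLike.norm_ofReal, hg, hf, one_mul] at h2
    exact (le_abs_self _).trans (h2.trans h3)
  have hxj : ∀ j, ‖x.1 j‖ ≤ 1 := fun j => hx ▸ norm_le_pi_norm x.1 j
  have hle : ∀ j ∈ Finset.univ, ‖x.1 j‖ * ‖c j‖ ≤ ‖c j‖ := fun j _ =>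
    mul_le_of_le_one_left (norm_nonneg _) (hxj j)
  have hx1 : 1 ≤ ∑ j, ‖x.1 j‖ * ‖c j‖ := by
    have h1 : ‖g x.1‖ = 1 := by rw [hgf, hfx, norm_one]
    rw [← h1, hsum]
    exact (norm_sum_le _ _).trans (Finset.sum_le_sum fun j _ => (norm_mul _ _).le)
  -- Equality throughout `1 ≤ ∑ ‖x j‖ ‖c j‖ ≤ ∑ ‖c j‖ ≤ 1` forces `‖x j‖ = 1` wherever `c j ≠ 0`.
  have heq := (Finset.sum_eq_sum_iff_of_le hle).1
    (le_antisymm (Finset.sum_le_sum hle) (hc1.trans hx1))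
  rw [← hgf, hsum]
  calc ‖∑ j, y.1 j * c j‖ ≤ ∑ j, C * ‖c j‖ := by
        refine (norm_sum_le _ _).trans (Finset.sum_le_sum fun j hj => ?_)
        rw [norm_mul]
        by_cases hcj : ‖c j‖ = 0
        · rw [hcj, mul_zero, mul_zero]
        · exact mul_le_mul_of_nonneg_right (h j ((mul_eq_right₀ hcj).1 (heq j hj)))
            (norm_nonneg _)
    _ = C * ∑ j, ‖c j‖ := by rw [Finset.mul_sum]
    _ ≤ C := mul_le_of_le_one_right hC hc1

end NumericalIndex

/-! ### The numerical index of the hexagonal space -/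

section Hexagon

variable (𝕜 : Type u) [RCLike 𝕜]

/-- The operator `(a, b, c) ↦ ((b - c) / 2, (c - a) / 2, (a - b) / 2)` on `hexSpace`. -/
noncomputable def hexRotation : hexSpace 𝕜 →L[𝕜] hexSpace 𝕜 :=
  LinearMap.mkContinuous
    { toFun := fun w => ⟨fun j => (w.1 (j + 1) - w.1 (j + 2)) / 2, by
        change (w.1 1 - w.1 2) / 2 + (w.1 2 - w.1 0) / 2 + (w.1 0 - w.1 1) / 2 = 0
        ring⟩
      map_add' := fun v w => by
        ext j
        change (v.1 _ + w.1 _ - (v.1 _ + w.1 _)) / 2 = (v.1 _ - v.1 _) / 2 + (w.1 _ - w.1 _) / 2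
        ring
      map_smul' := fun r w => by
        ext j
        change (r * w.1 _ - r * w.1 _) / 2 = r * ((w.1 _ - w.1 _) / 2)
        ring } 1 fun w => by
    rw [one_mul]
    refine (pi_norm_le_iff_of_nonneg (norm_nonneg w)).2 fun j => ?_
    change ‖(w.1 (j + 1) - w.1 (j + 2)) / 2‖ ≤ ‖w‖
    rw [norm_div, RCLike.norm_ofNat]
    have h1 : ‖w.1 (j + 1)‖ ≤ ‖w‖ := norm_le_pi_norm w.1 _
    have h2 : ‖w.1 (j + 2)‖ ≤ ‖w‖ := norm_le_pi_norm w.1 _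
    linarith [norm_sub_le (w.1 (j + 1)) (w.1 (j + 2))]

theorem hexRotation_apply (w : hexSpace 𝕜) (j : Fin 3) :
    (hexRotation 𝕜 w).1 j = (w.1 (j + 1) - w.1 (j + 2)) / 2 := rfl

/-- The vector `(0, 1, -1)` of `hexSpace`. -/
def hexVector : hexSpace 𝕜 := ⟨![0, 1, -1], by
  change (0 : 𝕜) + 1 + -1 = 0
  ring⟩

theorem norm_hexVector : ‖hexVector 𝕜‖ = 1 := by
  refine le_antisymm ((pi_norm_le_iff_of_nonneg zero_le_one).2 fun j => ?_) ?_
  · fin_cases j <;> simp [hexVector]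
  · have h : ‖(hexVector 𝕜).1 1‖ ≤ ‖hexVector 𝕜‖ := norm_le_pi_norm _ _
    simpa [hexVector] using h

instance : Nontrivial (hexSpace 𝕜) :=
  ⟨hexVector 𝕜, 0, norm_ne_zero_iff.1 (by rw [norm_hexVector]; exact one_ne_zero)⟩

theorem norm_hexRotation : ‖hexRotation 𝕜‖ = 1 := by
  refine le_antisymm (LinearMap.mkContinuous_norm_le _ zero_le_one _) ?_
  have h1 := (hexRotation 𝕜).le_opNorm (hexVector 𝕜)
  have h2 : ‖(hexRotation 𝕜 (hexVector 𝕜)).1 0‖ ≤ ‖hexRotation 𝕜 (hexVector 𝕜)‖ :=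
    norm_le_pi_norm _ _
  have h3 : (hexRotation 𝕜 (hexVector 𝕜)).1 0 = 1 := by
    rw [hexRotation_apply]
    simp [hexVector]
  rw [h3, norm_one] at h2
  rw [norm_hexVector, mul_one] at h1
  exact h2.trans h1

theorem norm_hexRotation_apply_le {w : hexSpace 𝕜} (hw : ‖w‖ = 1) {j : Fin 3}
    (hj : ‖w.1 j‖ = 1) : ‖(hexRotation 𝕜 w).1 j‖ ≤ √3 / 2 := by
  have hle : ∀ i, ‖w.1 i‖ ≤ 1 := fun i => hw ▸ norm_le_pi_norm w.1 i
  have hsum : w.1 (j + 1) + w.1 (j + 2) = -w.1 j := by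
    have h : w.1 0 + w.1 1 + w.1 2 = 0 := w.2
    fin_cases j
    · change w.1 1 + w.1 2 = -w.1 0
      linear_combination h
    · change w.1 2 + w.1 0 = -w.1 1
      linear_combination h
    · change w.1 0 + w.1 1 = -w.1 2
      linear_combination h
  -- The two other entries have modulus at most one and a sum of modulus one, so their difference
  -- has squared modulus at most `4 - 1 = 3`.
  have hpar := parallelogram_law_with_norm 𝕜 (w.1 (j + 1)) (w.1 (j + 2))
  rw [hsum, norm_neg, hj] at hpar
  rw [hexRotation_apply, norm_div, RCLike.norm_ofNat]
  refine div_le_div_of_nonneg_right (Real.le_sqrt_of_sq_le ?_) zero_le_two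
  nlinarith [hle (j + 1), hle (j + 2), norm_nonneg (w.1 (j + 1)), norm_nonneg (w.1 (j + 2))]

theorem numericalIndex_hexSpace_lt_one : numericalIndex 𝕜 (hexSpace 𝕜) < 1 := by
  have h : numericalRadius 𝕜 (hexRotation 𝕜) ≤ √3 / 2 :=
    numericalRadius_le (by positivity) fun x f hx hf hfx =>
      norm_apply_le_of_support hx hf hfx (fun j hj => norm_hexRotation_apply_le 𝕜 hx hj)
        (by positivity)
  refine ((numericalIndex_le (norm_hexRotation 𝕜)).trans h).trans_lt ?_
  rw [div_lt_one two_pos, Real.sqrt_lt' two_pos]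
  norm_num

/-- In `X₂` the hexagonal coordinate `none` is not the distinguished one, unlike in `X₁`. -/
theorem isometricToMSummand_hexSpace : IsometricToMSummand 𝕜 (hexSpace 𝕜) (spaceX₂ 𝕜) :=
  (coordSystemX₂ 𝕜).isometricToMSummand (i := none) (by simp)

end Hexagon

/-! ### The numerical index of the first predual -/

section SpaceX₁

variable (𝕜 : Type u) [RCLike 𝕜]

/-- The vector of `X₁` whose only nonzero entry is the `k.2`-th term of component `k.1`. -/
noncomputable def unitVectorX₁ (k : Fin 3 × ℕ) : spaceX₁ 𝕜 :=
  ⟨tensorRight 𝕜 (Fin 3) (unitSeq 𝕜 k.2) (Pi.single k.1 1), by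
    have h : componentwise (Fin 3) (seqLimCLM 𝕜) (tensorRight 𝕜 (Fin 3) (unitSeq 𝕜 k.2)
        (Pi.single k.1 1)) = 0 := by
      rw [componentwise_tensorRight, seqLimCLM_apply, seqLim_unitSeq, zero_smul]
    have h' : componentwise (Fin 3) (seqLimCLM 𝕜) (tensorRight 𝕜 (Fin 3) (unitSeq 𝕜 k.2)
        (Pi.single k.1 1)) ∈ hexSpace 𝕜 := h ▸ zero_mem _
    exact h'⟩

/-- The term of index `k.2` of component `k.1` as a functional on `X₁`. -/
noncomputable def evalX₁ (k : Fin 3 × ℕ) : StrongDual 𝕜 (spaceX₁ 𝕜) :=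
  ((seqEvalCLM 𝕜 k.2).comp (ContinuousLinearMap.proj k.1)).comp (spaceX₁ 𝕜).subtypeL

theorem evalX₁_unitVectorX₁ (k l : Fin 3 × ℕ) :
    evalX₁ 𝕜 l (unitVectorX₁ 𝕜 k) =
      (Pi.single k.1 1 : Fin 3 → 𝕜) l.1 * (unitSeq 𝕜 k.2).1 l.2 := rfl

theorem evalX₁_unitVectorX₁_self (k : Fin 3 × ℕ) : evalX₁ 𝕜 k (unitVectorX₁ 𝕜 k) = 1 := by
  rw [evalX₁_unitVectorX₁, Pi.single_eq_same, unitSeq_apply_self, mul_one]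

theorem evalX₁_unitVectorX₁_ne {k l : Fin 3 × ℕ} (h : l ≠ k) :
    evalX₁ 𝕜 l (unitVectorX₁ 𝕜 k) = 0 := by
  rw [evalX₁_unitVectorX₁]
  by_cases h1 : l.1 = k.1
  · rw [unitSeq_apply_ne fun h2 => h (Prod.ext h1 h2), mul_zero]
  · rw [Pi.single_eq_of_ne h1, zero_mul]

instance : Nontrivial (spaceX₁ 𝕜) :=
  ⟨unitVectorX₁ 𝕜 0, 0, fun h => by
    have := evalX₁_unitVectorX₁_self 𝕜 0
    rw [h, map_zero] at this
    exact zero_ne_one this⟩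

/-- A vector with a single nonzero term has zero limits and so lies in `X₁`: each scalar term can be
varied independently. -/
theorem numericalIndex_spaceX₁ : numericalIndex 𝕜 (spaceX₁ 𝕜) = 1 :=
  numericalIndex_eq_one (norm_le_numericalRadius_of_coordinates (evalX₁ 𝕜) (unitVectorX₁ 𝕜)
    (fun k w => (convSeq_norm_apply_le (w.1 k.1) k.2).trans (norm_le_pi_norm w.1 k.1))
    (fun _ _ hr h => (pi_norm_le_iff_of_nonneg hr).2 fun j =>
      convSeq_norm_le hr fun n => h (j, n))
    (evalX₁_unitVectorX₁_self 𝕜) fun _ _ => evalX₁_unitVectorX₁_ne 𝕜)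

end SpaceX₁

theorem mainTheorem7 (𝕜 : Type u) [RCLike 𝕜] :
    (∃ (Z : Type u) (_ : NormedAddCommGroup Z) (_ : NormedSpace 𝕜 Z),
      CompleteSpace Z ∧
      IsIsometricPredual 𝕜 (spaceX₁ 𝕜) Z ∧ IsIsometricPredual 𝕜 (spaceX₂ 𝕜) Z) ∧
    numericalIndex 𝕜 (spaceX₁ 𝕜) ≠ numericalIndex 𝕜 (spaceX₂ 𝕜) ∧
    numericalIndex 𝕜 (spaceX₁ 𝕜) = 1 ∧
    IsometricToMSummand 𝕜 (hexSpace 𝕜) (spaceX₂ 𝕜) ∧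
    numericalIndex 𝕜 (hexSpace 𝕜) < 1 ∧
    numericalIndex 𝕜 (spaceX₂ 𝕜) < 1 := by
  have h₂ : numericalIndex 𝕜 (spaceX₂ 𝕜) < 1 :=
    (isometricToMSummand_hexSpace 𝕜).numericalIndex_le.trans_lt
      (numericalIndex_hexSpace_lt_one 𝕜)
  refine ⟨⟨lp (fun i => StrongDual 𝕜 (coordSpace 𝕜 i)) 1, inferInstance, inferInstance,
    inferInstance, ⟨inferInstance, (coordSystemX₁ 𝕜).nonempty_dual_linearIsometryEquiv⟩,
    ⟨inferInstance, (coordSystemX₂ 𝕜).nonempty_dual_linearIsometryEquiv⟩⟩, ?_,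
    numericalIndex_spaceX₁ 𝕜, isometricToMSummand_hexSpace 𝕜,
    numericalIndex_hexSpace_lt_one 𝕜, h₂⟩
  rw [numericalIndex_spaceX₁]
  exact h₂.ne'
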